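/- Let $\mathbb Z_+=\{0,1,2,\dots\}$ and let $C(\mathbb Z_+\times\mathbb R,\mathbb R)$ be the space of continuous functions with the compact-open topology ($\mathbb Z_+$ discrete). For $f\in C(\mathbb Z_+\times\mathbb R,\mathbb R)$ and $h\in\mathbb Z_+$ put $f^h(t,x):=f(t+h,x)$. The function $f$ is positively Lagrange stable if $\{f^h : h\in\mathbb Z_+\}$ is precompact in $C(\mathbb Z_+\times\mathbb R,\mathbb R)$; $\omega_f$ is the set of all limits of convergent sequences $f^{t_k}$ with $t_k\to+\infty$; a nonempty set $M\subseteq C(\mathbb Z_+\times\mathbb R,\mathbb R)$ is minimal if $M=\overline{\{g^h : h\in\mathbb Z_+\}}$ for every $g\in M$. A set $P\subseteq\mathbb Z_+$ is relatively dense if there is $l>0$ in $\mathbb Z_+$ such that $P\cap[a,a+l]\neq\emptyset$ for all $a\in\mathbb Z_+$. The function $f$ is called remotely almost periodic in $t$ uniformly with respect to $x$ on compacta if for every compact $Q\subset\mathbb R$ and every $\varepsilon>0$ there is a relatively dense set $P\subseteq\mathbb Z_+$ such that for every $\tau\in P$ there is $L$ with $|f(t+\tau,x)-f(t,x)|<\varepsilon$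 for all $t\ge L$ and $x\in Q$. It is called remotely $\tau$-periodic ($\tau\in\mathbb Z_+$, $\tau>0$) in $t$ uniformly with respect to $x$ on compacta if $\lim_{t\to+\infty}|f(t+\tau,x)-f(t,x)|=0$ uniformly in $x\in Q$ for every compact $Q\subset\mathbb R$, and remotely stationary if this holds for every $\tau\in\mathbb Z_+$. The same terms for a function $u:\mathbb Z_+\to\mathbb R$ are defined in the same way, without $x$ and $Q$. Theorem. Let $f\in C(\mathbb Z_+\times\mathbb R,\mathbb R)$ be positively Lagrange stable and remotely almost periodic (respectively, remotely $\tau$-periodic or remotely stationary) in $t$ uniformly with respect to $x$ on compacta. Suppose that $\omega_f$ is minimal, that $f(t,x_1)\le f(t,x_2)$ for all $t\in\mathbb Z_+$ and $x_1\le x_2$, and that $|f(t,x_1)-f(t,x_2)|\le|x_1-x_2|$ for all $t\in\mathbb Z_+$ and $x_1,x_2\in\mathbb R$. Then every solution $u:\mathbb Z_+\to\mathbb R$ of $u(t+1)=f(t,u(t))$, $t\in\mathbb Z_+$, that is bounded on $\mathbb Z_+$ is remotely almost periodic (respectively, remotely $\tau$-periodic or remotely stationary). -/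

import Mathlib

open Filter Topology

namespace RemoteAP

/-- The `h`-translate `f^h(t, x) = f(t + h, x)` on `C(ℤ₊ × ℝ, ℝ)`, a space which carries the
compact-open topology. -/
def shift (h : ℕ) (f : C(ℕ × ℝ, ℝ)) : C(ℕ × ℝ, ℝ) :=
  f.comp ⟨fun p : ℕ × ℝ => (p.1 + h, p.2), by fun_prop⟩

/-- The set of all translates `f^h`, `h ∈ ℤ₊`. -/
def orbit (f : C(ℕ × ℝ, ℝ)) : Set C(ℕ × ℝ, ℝ) :=
  Set.range fun h : ℕ => shift h f

/-- The set of translates is precompact in `C(ℤ₊ × ℝ, ℝ)`. -/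
def PositivelyLagrangeStable (f : C(ℕ × ℝ, ℝ)) : Prop :=
  IsCompact (closure (orbit f))

/-- The set of `ω`-limit points of `f` in the shift dynamical system. -/
def omegaLimitSet (f : C(ℕ × ℝ, ℝ)) : Set C(ℕ × ℝ, ℝ) :=
  {g | ∃ t : ℕ → ℕ, Tendsto t atTop atTop ∧ Tendsto (fun k => shift (t k) f) atTop (𝓝 g)}

/-- A minimal set of the shift dynamical system: a nonempty set that is the closure of the
trajectory of each of its points (so it is closed and positively invariant). -/
def IsMinimalSet (M : Set C(ℕ × ℝ, ℝ)) : Prop :=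
  M.Nonempty ∧ ∀ g ∈ M, closure (orbit g) = M

/-- Some `l > 0` is such that every segment `[a, a + l]` of `ℤ₊` meets `A`. -/
def RelativelyDense (A : Set ℕ) : Prop :=
  ∃ l : ℕ, 0 < l ∧ ∀ a : ℕ, (Set.Icc a (a + l) ∩ A).Nonempty

/-- Remote almost periodicity of a function on `ℤ₊`. -/
def RemotelyAlmostPeriodic (u : ℕ → ℝ) : Prop :=
  ∀ ε : ℝ, 0 < ε → ∃ P : Set ℕ, RelativelyDense P ∧
    ∀ τ ∈ P, ∃ L : ℕ, ∀ t : ℕ, L ≤ t → |u (t + τ) - u t| < ε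

/-- Remote `τ`-periodicity of a function on `ℤ₊`. -/
def RemotelyPeriodic (τ : ℕ) (u : ℕ → ℝ) : Prop :=
  Tendsto (fun t : ℕ => |u (t + τ) - u t|) atTop (𝓝 0)

/-- Remote stationarity of a function on `ℤ₊`. -/
def RemotelyStationary (u : ℕ → ℝ) : Prop :=
  ∀ τ : ℕ, RemotelyPeriodic τ u

/-- Remote almost periodicity in `t`, uniformly with respect to `x` on every compact `Q ⊆ ℝ`. -/
def RemotelyAlmostPeriodicUnif (f : C(ℕ × ℝ, ℝ)) : Prop :=
  ∀ Q : Set ℝ, IsCompact Q → ∀ ε : ℝ, 0 < ε → ∃ P : Set ℕ, RelativelyDense P ∧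
    ∀ τ ∈ P, ∃ L : ℕ, ∀ t : ℕ, L ≤ t → ∀ x ∈ Q, |f (t + τ, x) - f (t, x)| < ε

/-- Remote `τ`-periodicity in `t`, uniformly with respect to `x` on every compact `Q ⊆ ℝ`. -/
def RemotelyPeriodicUnif (τ : ℕ) (f : C(ℕ × ℝ, ℝ)) : Prop :=
  ∀ Q : Set ℝ, IsCompact Q → ∀ ε : ℝ, 0 < ε →
    ∃ L : ℕ, ∀ t : ℕ, L ≤ t → ∀ x ∈ Q, |f (t + τ, x) - f (t, x)| < ε

/-- Remote stationarity in `t`, uniformly with respect to `x` on every compact `Q ⊆ ℝ`. -/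
def RemotelyStationaryUnif (f : C(ℕ × ℝ, ℝ)) : Prop :=
  ∀ τ : ℕ, RemotelyPeriodicUnif τ f

/-- `u` solves the difference equation `u(t + 1) = f(t, u(t))` on `ℤ₊`. -/
def IsSolution (f : C(ℕ × ℝ, ℝ)) (u : ℕ → ℝ) : Prop :=
  ∀ t : ℕ, u (t + 1) = f (t, u t)

end RemoteAP

/-! ### Two-sided limits of translates -/

namespace RemoteAP

/-! Pass to the limits `(g, v)` of translates of `(f, u)`. They form a compact translation-invariant
set, and each `v` is a full solution for a monotone nonexpansive `g`. Two states over one `g` keep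
their order, and their gap never grows forward in time. Let `δ` be the largest gap. Going backward a
gap `δ` persists, so a backward limit carries it at all times, and minimality of `ω_f` spreads it to
every limit right-hand side (`mem_gapSet_of_isMinimalSet`). A state squeezed between two states at
constant distance `δ` keeps its distance to both (`exists_extremal`), so its increments are those of
the upper one. The value of an upper extremal state at time `0` is determined by `g`, and by
compactness a shift that nearly fixes `g` nearly fixes this value
(`exists_forall_limitPairs_abs_sub_lt`). Hence remote near-periods of `f` are remote near-periods of
`u`. -/

/-- A two-sided sequence of right-hand sides together with a two-sided sequence of states, with
the topology of pointwise convergence. -/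
abbrev TwoSided := (ℤ → ℝ → ℝ) × (ℤ → ℝ)

/-- Time translation on the two-sided space. -/
def translate (n : ℤ) (p : TwoSided) : TwoSided :=
  (fun s => p.1 (s + n), fun s => p.2 (s + n))

/-- The translate by `t` of `(f, u)`, extended to negative times by the values at time `0`. -/
def extend (f : C(ℕ × ℝ, ℝ)) (u : ℕ → ℝ) (t : ℤ) : TwoSided :=
  (fun s x => f ((s + t).toNat, x), fun s => u (s + t).toNat)

/-- The limit points of the translates of `(f, u)` as time tends to infinity. -/
def limitPairs (f : C(ℕ × ℝ, ℝ)) (u : ℕ → ℝ) : Set TwoSided :=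
  {p | MapClusterPt p atTop (extend f u)}

theorem continuous_translate (n : ℤ) : Continuous (translate n) := by
  unfold translate
  fun_prop

theorem translate_extend (f : C(ℕ × ℝ, ℝ)) (u : ℕ → ℝ) (n t : ℤ) :
    translate n (extend f u t) = extend f u (t + n) := by
  simp [translate, extend, add_assoc, add_comm n t]

theorem exists_tendsto_of_isCompact {X ι : Type*} [TopologicalSpace X] {S : Set X}
    (hS : IsCompact S) (U : Ultrafilter ι) {x : ι → X} (hx : ∀ᶠ i in (U : Filter ι), x i ∈ S) :
    ∃ p ∈ S, Tendsto x U (𝓝 p) := by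
  obtain ⟨p, hp, h⟩ := hS.ultrafilter_le_nhds (U.map x) (le_principal_iff.2 hx)
  exact ⟨p, hp, h⟩

theorem mem_limitPairs_iff {f : C(ℕ × ℝ, ℝ)} {u : ℕ → ℝ} {p : TwoSided} :
    p ∈ limitPairs f u ↔
      ∃ U : Ultrafilter ℤ, (U : Filter ℤ) ≤ atTop ∧ Tendsto (extend f u) U (𝓝 p) :=
  mapClusterPt_iff_ultrafilter

theorem translate_mem_limitPairs {f : C(ℕ × ℝ, ℝ)} {u : ℕ → ℝ} {p : TwoSided}
    (hp : p ∈ limitPairs f u) (n : ℤ) : translate n p ∈ limitPairs f u := by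
  obtain ⟨U, hU, h⟩ := mem_limitPairs_iff.1 hp
  refine mem_limitPairs_iff.2 ⟨U.map (· + n), ?_, ?_⟩
  · exact (tendsto_atTop_add_const_right atTop n tendsto_id).mono_left hU
  · have h2 := ((continuous_translate n).tendsto p).comp h
    simp only [Ultrafilter.coe_map, tendsto_map'_iff]
    refine h2.congr fun t => ?_
    simp [translate_extend]

/-! ### Compactness -/

section Bounds

variable {f : C(ℕ × ℝ, ℝ)} {u : ℕ → ℝ} {C : ℝ}

theorem exists_isCompact_forall_extend_mem
    (hLip : ∀ (t : ℕ) (x₁ x₂ : ℝ), |f (t, x₁) - f (t, x₂)| ≤ |x₁ - x₂|)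
    (hu : IsSolution f u) (hC : ∀ t, |u t| ≤ C) :
    ∃ S : Set TwoSided, IsCompact S ∧ ∀ t, extend f u t ∈ S := by
  -- Since `f (r, u r) = u (r + 1)`, nonexpansiveness gives `|f (r, x)| ≤ C + |x - u r| ≤ 2 * C +
  -- |x|`.
  refine ⟨(Set.univ.pi fun _ => Set.univ.pi fun x => Set.Icc (-(2 * C + |x|)) (2 * C + |x|)) ×ˢ
    (Set.univ.pi fun _ => Set.Icc (-C) C), ?_, fun t => ?_⟩
  · exact (isCompact_univ_pi fun _ => isCompact_univ_pi fun _ => isCompact_Icc).prod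
      (isCompact_univ_pi fun _ => isCompact_Icc)
  · simp only [Set.mem_prod, Set.mem_univ_pi, Set.mem_Icc, ← abs_le]
    refine ⟨fun s x => ?_, fun s => hC _⟩
    change |f ((s + t).toNat, x)| ≤ _
    generalize (s + t).toNat = r
    have h1 := hLip r x (u r)
    have h2 := hC (r + 1)
    have h3 := hC r
    rw [hu r] at h2
    have h4 := abs_sub x (u r)
    have h5 := abs_sub_abs_le_abs_sub (f (r, x)) (f (r, u r))
    linarith

theorem isCompact_limitPairs
    (hLip : ∀ (t : ℕ) (x₁ x₂ : ℝ), |f (t, x₁) - f (t, x₂)| ≤ |x₁ - x₂|)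
    (hu : IsSolution f u) (hC : ∀ t, |u t| ≤ C) : IsCompact (limitPairs f u) := by
  obtain ⟨S, hS, h⟩ := exists_isCompact_forall_extend_mem hLip hu hC
  refine hS.of_isClosed_subset isClosed_setOfPred_clusterPt fun p hp => ?_
  obtain ⟨U, -, hp⟩ := mem_limitPairs_iff.1 hp
  exact hS.isClosed.mem_of_tendsto hp (Eventually.of_forall h)

theorem exists_tendsto_extend
    (hLip : ∀ (t : ℕ) (x₁ x₂ : ℝ), |f (t, x₁) - f (t, x₂)| ≤ |x₁ - x₂|)
    (hu : IsSolution f u) (hC : ∀ t, |u t| ≤ C) (U : Ultrafilter ℤ) (hU : (U : Filter ℤ) ≤ atTop) :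
    ∃ p ∈ limitPairs f u, Tendsto (extend f u) U (𝓝 p) := by
  obtain ⟨S, hS, h⟩ := exists_isCompact_forall_extend_mem hLip hu hC
  obtain ⟨p, -, hp⟩ := exists_tendsto_of_isCompact hS U (Eventually.of_forall h)
  exact ⟨p, mem_limitPairs_iff.2 ⟨U, hU, hp⟩, hp⟩

theorem limitPairs_nonempty
    (hLip : ∀ (t : ℕ) (x₁ x₂ : ℝ), |f (t, x₁) - f (t, x₂)| ≤ |x₁ - x₂|)
    (hu : IsSolution f u) (hC : ∀ t, |u t| ≤ C) : (limitPairs f u).Nonempty := by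
  obtain ⟨p, hp, -⟩ := exists_tendsto_extend hLip hu hC (Ultrafilter.of atTop)
    (Ultrafilter.of_le atTop)
  exact ⟨p, hp⟩

end Bounds

/-! ### Limit dynamics -/

section Pointwise

variable {f : C(ℕ × ℝ, ℝ)} {u : ℕ → ℝ} {U : Ultrafilter ℤ} {p : TwoSided}

theorem tendsto_extend_fst (h : Tendsto (extend f u) U (𝓝 p)) (s : ℤ) (x : ℝ) :
    Tendsto (fun t : ℤ => f ((s + t).toNat, x)) U (𝓝 (p.1 s x)) :=
  have hc : Continuous fun p : TwoSided => p.1 s x := by fun_prop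
  (hc.tendsto p).comp h

theorem tendsto_extend_snd (h : Tendsto (extend f u) U (𝓝 p)) (s : ℤ) :
    Tendsto (fun t : ℤ => u (s + t).toNat) U (𝓝 (p.2 s)) :=
  have hc : Continuous fun p : TwoSided => p.2 s := by fun_prop
  (hc.tendsto p).comp h

theorem limitPairs_monotone (hmono : ∀ (t : ℕ) (x₁ x₂ : ℝ), x₁ ≤ x₂ → f (t, x₁) ≤ f (t, x₂))
    (hp : p ∈ limitPairs f u) (s : ℤ) {x y : ℝ} (hxy : x ≤ y) : p.1 s x ≤ p.1 s y := by
  obtain ⟨U, -, h⟩ := mem_limitPairs_iff.1 hp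
  exact le_of_tendsto_of_tendsto' (tendsto_extend_fst h s x) (tendsto_extend_fst h s y)
    fun t => hmono _ _ _ hxy

theorem limitPairs_lipschitz
    (hLip : ∀ (t : ℕ) (x₁ x₂ : ℝ), |f (t, x₁) - f (t, x₂)| ≤ |x₁ - x₂|)
    (hp : p ∈ limitPairs f u) (s : ℤ) (x y : ℝ) : |p.1 s x - p.1 s y| ≤ |x - y| := by
  obtain ⟨U, -, h⟩ := mem_limitPairs_iff.1 hp
  exact le_of_tendsto' ((tendsto_extend_fst h s x).sub (tendsto_extend_fst h s y)).abs
    fun t => hLip _ _ _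

theorem limitPairs_solution
    (hLip : ∀ (t : ℕ) (x₁ x₂ : ℝ), |f (t, x₁) - f (t, x₂)| ≤ |x₁ - x₂|)
    (hu : IsSolution f u) (hp : p ∈ limitPairs f u) (s : ℤ) :
    p.2 (s + 1) = p.1 s (p.2 s) := by
  obtain ⟨U, hU, h⟩ := mem_limitPairs_iff.1 hp
  -- Convergence of the right-hand sides is only pointwise; the Lipschitz bound replaces the moving
  -- argument by its limit.
  have h1 : Tendsto (fun t : ℤ => f ((s + t).toNat, u (s + t).toNat) - f ((s + t).toNat, p.2 s))
      U (𝓝 0) := by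
    rw [tendsto_zero_iff_abs_tendsto_zero]
    have h2 := ((tendsto_extend_snd h s).sub_const (p.2 s)).abs
    simp only [sub_self, abs_zero] at h2
    exact squeeze_zero (fun t => abs_nonneg _) (fun t => hLip _ _ _) h2
  have h3 := h1.add (tendsto_extend_fst h s (p.2 s))
  simp only [sub_add_cancel, zero_add] at h3
  refine tendsto_nhds_unique (tendsto_extend_snd h (s + 1)) (h3.congr' ?_)
  filter_upwards [hU (eventually_ge_atTop (-s))] with t ht
  rw [show (s + 1 + t).toNat = (s + t).toNat + 1 by lia, hu]

/-- Two limit states over the same right-hand side keep their order, and their distance does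
not increase. -/
theorem limitPairs_sub_mem_Icc
    (hmono : ∀ (t : ℕ) (x₁ x₂ : ℝ), x₁ ≤ x₂ → f (t, x₁) ≤ f (t, x₂))
    (hLip : ∀ (t : ℕ) (x₁ x₂ : ℝ), |f (t, x₁) - f (t, x₂)| ≤ |x₁ - x₂|)
    (hu : IsSolution f u) {g : ℤ → ℝ → ℝ} {v w : ℤ → ℝ} (hv : (g, v) ∈ limitPairs f u)
    (hw : (g, w) ∈ limitPairs f u) {s : ℤ} (hvw : v s ≤ w s) (n : ℕ) :
    0 ≤ w (s + n) - v (s + n) ∧ w (s + n) - v (s + n) ≤ w s - v s := by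
  induction n with
  | zero => simpa using hvw
  | succ n ih =>
    have h1 := limitPairs_solution hLip hu hv (s + n)
    have h2 := limitPairs_solution hLip hu hw (s + n)
    have h3 := limitPairs_monotone hmono hv (s + n) (sub_nonneg.1 ih.1)
    have h4 := (le_abs_self _).trans
      (limitPairs_lipschitz hLip hv (s + n) (w (s + n)) (v (s + n)))
    rw [abs_of_nonneg ih.1] at h4
    simp only [add_assoc] at h1 h2
    push_cast
    simp only at h1 h2 h3 h4 ⊢
    rw [h1, h2]
    constructor <;> linarith [ih.2]

end Pointwise

/-! ### Use of minimality -/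

theorem exists_mem_omegaLimitSet {f : C(ℕ × ℝ, ℝ)} {u : ℕ → ℝ} {p : TwoSided}
    (hLagrange : PositivelyLagrangeStable f) (hp : p ∈ limitPairs f u) :
    ∃ φ ∈ omegaLimitSet f, ∀ (n : ℕ) (x : ℝ), φ (n, x) = p.1 n x := by
  obtain ⟨U, hU, h⟩ := mem_limitPairs_iff.1 hp
  obtain ⟨φ, -, hφ⟩ := exists_tendsto_of_isCompact hLagrange U
    (x := fun t : ℤ => shift t.toNat f)
    (Eventually.of_forall fun t => subset_closure ⟨t.toNat, rfl⟩)
  refine ⟨φ, ?_, fun n x => ?_⟩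
  · have hc : MapClusterPt φ atTop fun t : ℕ => shift t f := by
      refine mapClusterPt_iff_ultrafilter.2 ⟨U.map Int.toNat, ?_, ?_⟩
      · refine Tendsto.mono_left ?_ hU
        exact tendsto_atTop.2 fun b => (eventually_ge_atTop (b : ℤ)).mono fun t ht => by lia
      · exact tendsto_map'_iff.2 hφ
    obtain ⟨ψ, hψ, hlim⟩ := hc.tendsto_subseq
    exact ⟨ψ, hψ.tendsto_atTop, hlim⟩
  · have h1 := ((ContinuousEvalConst.continuous_eval_const (n, x)).tendsto φ).comp hφ
    refine tendsto_nhds_unique h1 ((tendsto_extend_fst h n x).congr' ?_)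
    filter_upwards [hU (eventually_ge_atTop 0)] with t ht
    simp only [shift, Function.comp, ContinuousMap.comp_apply, ContinuousMap.coe_mk]
    rw [show ((n : ℤ) + t).toNat = n + t.toNat by lia]

/-- Minimality makes each forward semi-orbit approach every limit right-hand side on each
half-line of times. -/
theorem exists_ultrafilter_tendsto_of_isMinimalSet {f : C(ℕ × ℝ, ℝ)} {u : ℕ → ℝ} {p q : TwoSided}
    (hLagrange : PositivelyLagrangeStable f) (hminimal : IsMinimalSet (omegaLimitSet f))
    (hp : p ∈ limitPairs f u) (hq : q ∈ limitPairs f u) (N : ℕ) :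
    ∃ V : Ultrafilter ℕ, ∀ s : ℤ, -N ≤ s → ∀ x : ℝ,
      Tendsto (fun n : ℕ => p.1 (s + n) x) V (𝓝 (q.1 s x)) := by
  -- Elements of `ω_f` see only times `≥ 0`; translating by `-N` first brings the times `≥ -N` into
  -- view.
  obtain ⟨φ, hφ, hφp⟩ := exists_mem_omegaLimitSet hLagrange (translate_mem_limitPairs hp (-N))
  obtain ⟨ψ, hψ, hψq⟩ := exists_mem_omegaLimitSet hLagrange (translate_mem_limitPairs hq (-N))
  rw [← hminimal.2 φ hφ] at hψ
  have hc : ∃ᶠ y in 𝓝 ψ, y ∈ orbit φ := mem_closure_iff_frequently.1 hψ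
  have hne : (comap (fun n : ℕ => shift n φ) (𝓝 ψ)).NeBot := by
    rw [comap_neBot_iff_frequently]
    exact hc
  refine ⟨Ultrafilter.of (comap (fun n : ℕ => shift n φ) (𝓝 ψ)), fun s hs x => ?_⟩
  have hV : Tendsto (fun n : ℕ => shift n φ)
      (Ultrafilter.of (comap (fun n : ℕ => shift n φ) (𝓝 ψ))) (𝓝 ψ) :=
    tendsto_comap.mono_left (Ultrafilter.of_le _)
  obtain ⟨m, rfl⟩ : ∃ m : ℕ, s = m + -N := ⟨(s + N).toNat, by lia⟩
  have h1 := ((ContinuousEvalConst.continuous_eval_const (m, x)).tendsto ψ).comp hV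
  rw [hψq] at h1
  refine h1.congr fun n => ?_
  simp only [shift, Function.comp, ContinuousMap.comp_apply, ContinuousMap.coe_mk, hφp, translate]
  rw [show ((m + n : ℕ) : ℤ) + -N = m + -N + n by lia]

end RemoteAP

/-! ### The maximal gap -/

namespace RemoteAP

/-- The right-hand sides that carry two limit states at distance at least `δ` at time `0`. -/
def gapSet (f : C(ℕ × ℝ, ℝ)) (u : ℕ → ℝ) (δ : ℝ) : Set (ℤ → ℝ → ℝ) :=
  {g | ∃ v w, (g, v) ∈ limitPairs f u ∧ (g, w) ∈ limitPairs f u ∧ δ ≤ |w 0 - v 0|}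

/-- The right-hand sides together with two limit states over them. -/
def limitTriples (f : C(ℕ × ℝ, ℝ)) (u : ℕ → ℝ) : Set ((ℤ → ℝ → ℝ) × (ℤ → ℝ) × (ℤ → ℝ)) :=
  {q | (q.1, q.2.1) ∈ limitPairs f u ∧ (q.1, q.2.2) ∈ limitPairs f u}

section Gap

variable {f : C(ℕ × ℝ, ℝ)} {u : ℕ → ℝ} {C : ℝ}

theorem isCompact_limitTriples
    (hLip : ∀ (t : ℕ) (x₁ x₂ : ℝ), |f (t, x₁) - f (t, x₂)| ≤ |x₁ - x₂|)
    (hu : IsSolution f u) (hC : ∀ t, |u t| ≤ C) : IsCompact (limitTriples f u) := by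
  have hK := isCompact_limitPairs hLip hu hC
  refine ((hK.image continuous_fst).prod
    ((hK.image continuous_snd).prod (hK.image continuous_snd))).of_isClosed_subset ?_ ?_
  · exact (hK.isClosed.preimage (by fun_prop : Continuous fun
        q : (ℤ → ℝ → ℝ) × (ℤ → ℝ) × (ℤ → ℝ) => (q.1, q.2.1))).inter
      (hK.isClosed.preimage (by fun_prop : Continuous fun
        q : (ℤ → ℝ → ℝ) × (ℤ → ℝ) × (ℤ → ℝ) => (q.1, q.2.2)))
  · rintro ⟨g, v, w⟩ ⟨hv, hw⟩
    exact ⟨⟨_, hv, rfl⟩, ⟨_, hv, rfl⟩, ⟨_, hw, rfl⟩⟩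

theorem isCompact_gapSet
    (hLip : ∀ (t : ℕ) (x₁ x₂ : ℝ), |f (t, x₁) - f (t, x₂)| ≤ |x₁ - x₂|)
    (hu : IsSolution f u) (hC : ∀ t, |u t| ≤ C) (δ : ℝ) : IsCompact (gapSet f u δ) := by
  have hc : Continuous fun q : (ℤ → ℝ → ℝ) × (ℤ → ℝ) × (ℤ → ℝ) => |q.2.2 0 - q.2.1 0| := by
    fun_prop
  have h := ((isCompact_limitTriples hLip hu hC).inter_right
    (isClosed_le continuous_const hc : IsClosed {q | δ ≤ |q.2.2 0 - q.2.1 0|})).image continuous_fst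
  convert h using 1
  ext g
  constructor
  · rintro ⟨v, w, hv, hw, hδ⟩
    exact ⟨(g, v, w), ⟨⟨hv, hw⟩, hδ⟩, rfl⟩
  · rintro ⟨⟨g, v, w⟩, ⟨⟨hv, hw⟩, hδ⟩, rfl⟩
    exact ⟨v, w, hv, hw, hδ⟩

/-- Compactness gives a maximum at time `0`; translation invariance carries the bound to all times.
-/
theorem exists_maximal_gap
    (hLip : ∀ (t : ℕ) (x₁ x₂ : ℝ), |f (t, x₁) - f (t, x₂)| ≤ |x₁ - x₂|)
    (hu : IsSolution f u) (hC : ∀ t, |u t| ≤ C) :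
    ∃ δ : ℝ, (gapSet f u δ).Nonempty ∧ ∀ g v w, (g, v) ∈ limitPairs f u →
      (g, w) ∈ limitPairs f u → ∀ s, |w s - v s| ≤ δ := by
  have hc : Continuous fun q : (ℤ → ℝ → ℝ) × (ℤ → ℝ) × (ℤ → ℝ) => |q.2.2 0 - q.2.1 0| := by
    fun_prop
  obtain ⟨p, hp⟩ := limitPairs_nonempty hLip hu hC
  obtain ⟨⟨g, v, w⟩, ⟨hv, hw⟩, hmax⟩ := (isCompact_limitTriples hLip hu hC).exists_isMaxOn
    ⟨(p.1, p.2, p.2), hp, hp⟩ hc.continuousOn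
  refine ⟨|w 0 - v 0|, ⟨g, v, w, hv, hw, le_rfl⟩, fun g' v' w' hv' hw' s => ?_⟩
  have h := hmax (show (fun r => g' (r + s), fun r => v' (r + s), fun r => w' (r + s)) ∈
    limitTriples f u from ⟨translate_mem_limitPairs hv' s, translate_mem_limitPairs hw' s⟩)
  simpa using h

theorem abs_sub_le_abs_sub
    (hLip : ∀ (t : ℕ) (x₁ x₂ : ℝ), |f (t, x₁) - f (t, x₂)| ≤ |x₁ - x₂|)
    (hu : IsSolution f u) {g : ℤ → ℝ → ℝ} {v w : ℤ → ℝ} (hv : (g, v) ∈ limitPairs f u)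
    (hw : (g, w) ∈ limitPairs f u) (s : ℤ) (n : ℕ) :
    |w (s + n) - v (s + n)| ≤ |w s - v s| := by
  induction n with
  | zero => simp
  | succ n ih =>
    refine le_trans ?_ ih
    have h1 := limitPairs_solution hLip hu hv (s + n)
    have h2 := limitPairs_solution hLip hu hw (s + n)
    push_cast
    rw [← add_assoc]
    simp only at h1 h2
    rw [h1, h2]
    exact limitPairs_lipschitz hLip hv _ _ _

/-- Gaps cannot grow forward, so they cannot shrink backward. -/
theorem backward_mem_gapSet
    (hLip : ∀ (t : ℕ) (x₁ x₂ : ℝ), |f (t, x₁) - f (t, x₂)| ≤ |x₁ - x₂|)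
    (hu : IsSolution f u) {δ : ℝ} {g : ℤ → ℝ → ℝ} (hg : g ∈ gapSet f u δ) (n : ℕ) :
    (fun s => g (s + -n)) ∈ gapSet f u δ := by
  obtain ⟨v, w, hv, hw, hδ⟩ := hg
  refine ⟨_, _, translate_mem_limitPairs hv (-n), translate_mem_limitPairs hw (-n),
    hδ.trans ?_⟩
  simpa using abs_sub_le_abs_sub hLip hu hv hw (0 + -n) n

theorem mem_gapSet_of_isMinimalSet (hLagrange : PositivelyLagrangeStable f)
    (hminimal : IsMinimalSet (omegaLimitSet f))
    (hLip : ∀ (t : ℕ) (x₁ x₂ : ℝ), |f (t, x₁) - f (t, x₂)| ≤ |x₁ - x₂|)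
    (hu : IsSolution f u) (hC : ∀ t, |u t| ≤ C) {δ : ℝ} (hne : (gapSet f u δ).Nonempty)
    {q : TwoSided} (hq : q ∈ limitPairs f u) : q.1 ∈ gapSet f u δ := by
  obtain ⟨g, hg⟩ := hne
  have hcpt := isCompact_gapSet hLip hu hC δ
  obtain ⟨k, hk, hlim⟩ := exists_tendsto_of_isCompact hcpt (hyperfilter ℕ)
    (x := fun (n : ℕ) (s : ℤ) => g (s + -n))
    (Eventually.of_forall fun n => backward_mem_gapSet hLip hu hg n)
  -- The shift of `k` by `m` is a limit of shifts of `g` by `m - n`, which are backward once `n ≥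
  -- m`.
  have hforward (m : ℕ) : (fun s => k (s + m)) ∈ gapSet f u δ := by
    have hc : Continuous fun (h : ℤ → ℝ → ℝ) (s : ℤ) => h (s + m) := by fun_prop
    refine hcpt.isClosed.mem_of_tendsto ((hc.tendsto k).comp hlim) ?_
    have hle : (hyperfilter ℕ : Filter ℕ) ≤ atTop := by
      rw [← Nat.cofinite_eq_atTop]
      exact hyperfilter_le_cofinite
    filter_upwards [hle (eventually_ge_atTop m)] with n hn
    convert backward_mem_gapSet hLip hu hg (n - m) using 2 with s
    simp only [Function.comp]
    congr 1
    lia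
  obtain ⟨v, -, hv, -, -⟩ := hk
  -- Minimality controls only half-lines of times, so `q.1` is reached as the limit of such `h` for
  -- `N → ∞`.
  have hN (N : ℕ) : ∃ h ∈ gapSet f u δ, ∀ s : ℤ, -N ≤ s → ∀ x, h s x = q.1 s x := by
    obtain ⟨V, hV⟩ := exists_ultrafilter_tendsto_of_isMinimalSet hLagrange hminimal hv hq N
    obtain ⟨h, hh, hlim⟩ := exists_tendsto_of_isCompact hcpt V (Eventually.of_forall hforward)
    refine ⟨h, hh, fun s hs x => tendsto_nhds_unique ?_ (hV s hs x)⟩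
    exact tendsto_pi_nhds.1 (tendsto_pi_nhds.1 hlim s) x
  choose h hh heq using hN
  refine hcpt.isClosed.mem_of_tendsto (f := h) (b := atTop) ?_ (Eventually.of_forall hh)
  refine tendsto_pi_nhds.2 fun s => tendsto_pi_nhds.2 fun x => tendsto_const_nhds.congr' ?_
  filter_upwards [eventually_ge_atTop (-s).toNat] with N hN
  exact (heq N s (by lia) x).symm

/-- Over each limit right-hand side every limit state keeps its distance to an extremal one. -/
theorem exists_extremal
    (hmono : ∀ (t : ℕ) (x₁ x₂ : ℝ), x₁ ≤ x₂ → f (t, x₁) ≤ f (t, x₂))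
    (hLip : ∀ (t : ℕ) (x₁ x₂ : ℝ), |f (t, x₁) - f (t, x₂)| ≤ |x₁ - x₂|)
    (hu : IsSolution f u) {δ : ℝ} (hall : ∀ q ∈ limitPairs f u, q.1 ∈ gapSet f u δ)
    (hmax : ∀ g v w, (g, v) ∈ limitPairs f u → (g, w) ∈ limitPairs f u → ∀ s, |w s - v s| ≤ δ)
    {g : ℤ → ℝ → ℝ} {z : ℤ → ℝ} (hz : (g, z) ∈ limitPairs f u) (n : ℕ) :
    ∃ v w, (g, v) ∈ limitPairs f u ∧ (g, w) ∈ limitPairs f u ∧ w 0 - v 0 = δ ∧ w n - v n = δ ∧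
      z n - z 0 = w n - w 0 := by
  -- The gap is taken at the later time `n`: monotonicity in time and maximality then force it to
  -- equal `δ` at time `0` too.
  obtain ⟨v, w, hv, hw, hδ, hvw⟩ : ∃ v w, (g, v) ∈ limitPairs f u ∧ (g, w) ∈ limitPairs f u ∧
      δ ≤ |w n - v n| ∧ v 0 ≤ w 0 := by
    obtain ⟨v, w, hv, hw, hδ⟩ := hall _ (translate_mem_limitPairs hz n)
    have hv' := translate_mem_limitPairs hv (-n)
    have hw' := translate_mem_limitPairs hw (-n)
    simp only [translate, neg_add_cancel_right] at hv' hw'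
    rcases le_total (v (0 + -n)) (w (0 + -n)) with h | h
    · exact ⟨_, _, hv', hw', by simpa using hδ, h⟩
    · exact ⟨_, _, hw', hv', by simpa [abs_sub_comm] using hδ, h⟩
  have hwv := limitPairs_sub_mem_Icc hmono hLip hu hv hw hvw n
  simp only [zero_add] at hwv
  rw [abs_of_nonneg hwv.1] at hδ
  have h1 := abs_le.1 (hmax g v w hv hw 0)
  have h2 := abs_le.1 (hmax g v z hv hz 0)
  have h3 := abs_le.1 (hmax g z w hz hw 0)
  -- Maximality puts `z 0` between `v 0` and `w 0`. Both `z - v` and `w - z` are nonincreasing with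
  -- sum `δ` at both ends, so neither changes.
  have h4 := limitPairs_sub_mem_Icc hmono hLip hu hv hz (s := 0) (by linarith) n
  have h5 := limitPairs_sub_mem_Icc hmono hLip hu hz hw (s := 0) (by linarith) n
  simp only [zero_add] at h4 h5
  refine ⟨v, w, hv, hw, ?_, ?_, ?_⟩ <;> linarith

/-- If a shift moves the limit right-hand sides little, then it moves the limit states little. -/
theorem exists_forall_limitPairs_abs_sub_lt (hLagrange : PositivelyLagrangeStable f)
    (hminimal : IsMinimalSet (omegaLimitSet f))
    (hmono : ∀ (t : ℕ) (x₁ x₂ : ℝ), x₁ ≤ x₂ → f (t, x₁) ≤ f (t, x₂))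
    (hLip : ∀ (t : ℕ) (x₁ x₂ : ℝ), |f (t, x₁) - f (t, x₂)| ≤ |x₁ - x₂|)
    (hu : IsSolution f u) (hC : ∀ t, |u t| ≤ C) {ε : ℝ} (hε : 0 < ε) :
    ∃ n : ℕ, ∀ (τ : ℕ) (p : TwoSided), p ∈ limitPairs f u →
      (∀ (s : ℤ) (x : ℝ), |x| ≤ n → |p.1 (s + τ) x - p.1 s x| ≤ 1 / ((n : ℝ) + 1)) →
      |p.2 τ - p.2 0| < ε := by
  obtain ⟨δ, hne, hmax⟩ := exists_maximal_gap hLip hu hC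
  have hext := fun (p : TwoSided) (hp : p ∈ limitPairs f u) => exists_extremal hmono hLip hu
    (fun q hq => mem_gapSet_of_isMinimalSet hLagrange hminimal hLip hu hC hne hq) hmax hp
  by_contra! hcon
  choose τ p hp hpτ hε' using hcon
  choose v w hv hw h0 hτ hz using fun n => hext (p n) (hp n) (τ n)
  have hT := isCompact_limitTriples hLip hu hC
  obtain ⟨⟨g, a, b⟩, ⟨ha, hb⟩, hlim⟩ := exists_tendsto_of_isCompact hT (hyperfilter ℕ)
    (x := fun n => ((p n).1, v n, w n)) (Eventually.of_forall fun n => ⟨hv n, hw n⟩)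
  obtain ⟨⟨g', a', b'⟩, ⟨ha', hb'⟩, hlim'⟩ := exists_tendsto_of_isCompact hT (hyperfilter ℕ)
    (x := fun n => (fun s => (p n).1 (s + τ n), fun s => v n (s + τ n), fun s => w n (s + τ n)))
    (Eventually.of_forall fun n => ⟨translate_mem_limitPairs (hv n) (τ n),
      translate_mem_limitPairs (hw n) (τ n)⟩)
  have hle : (hyperfilter ℕ : Filter ℕ) ≤ atTop := by
    rw [← Nat.cofinite_eq_atTop]
    exact hyperfilter_le_cofinite
  rw [Prod.tendsto_iff, Prod.tendsto_iff] at hlim hlim'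
  obtain ⟨hg, hva, hwb⟩ := hlim
  obtain ⟨hg', hva', hwb'⟩ := hlim'
  replace hva := tendsto_pi_nhds.1 hva 0
  replace hwb := tendsto_pi_nhds.1 hwb 0
  replace hva' := tendsto_pi_nhds.1 hva' 0
  replace hwb' := tendsto_pi_nhds.1 hwb' 0
  simp only [zero_add] at hva hwb hva' hwb'
  -- The violations use radius `n` and tolerance `1 / (n + 1)`, so the shifted and unshifted
  -- right-hand sides share a limit.
  have hgg : g' = g := by
    ext s x
    have h1 := ((tendsto_pi_nhds.1 (tendsto_pi_nhds.1 hg' s) x).sub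
      (tendsto_pi_nhds.1 (tendsto_pi_nhds.1 hg s) x)).abs
    have h2 : |g' s x - g s x| ≤ 0 := by
      refine le_of_tendsto_of_tendsto h1 (tendsto_one_div_add_atTop_nhds_zero_nat.mono_left hle) ?_
      filter_upwards [hle (eventually_ge_atTop ⌈|x|⌉₊)] with n hn
      exact hpτ n s x (Nat.ceil_le.1 hn)
    exact sub_eq_zero.1 (abs_nonpos_iff.1 h2)
  subst hgg
  have hab : b 0 - a 0 = δ :=
    tendsto_nhds_unique (hwb.sub hva) (tendsto_const_nhds.congr fun n => (h0 n).symm)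
  have hab' : b' 0 - a' 0 = δ :=
    tendsto_nhds_unique (hwb'.sub hva') (tendsto_const_nhds.congr fun n => (hτ n).symm)
  -- Crossing the pairs: `b' 0 - a 0 ≤ δ` and `b 0 - a' 0 ≤ δ` give `b' 0 = b 0`.
  have h1 := abs_le.1 (hmax _ _ _ ha hb' 0)
  have h2 := abs_le.1 (hmax _ _ _ ha' hb 0)
  have h3 : ε ≤ |b' 0 - b 0| := by
    refine ge_of_tendsto' (hwb'.sub hwb).abs fun n => ?_
    rw [← hz n]
    exact hε' n
  rw [show b' 0 - b 0 = 0 by linarith, abs_zero] at h3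
  linarith

/-- A shift that is eventually a near-period of `f` on a suitable compact set is eventually a
near-period of the bounded solution `u`. -/
theorem exists_forall_eventually_abs_sub_lt (hLagrange : PositivelyLagrangeStable f)
    (hminimal : IsMinimalSet (omegaLimitSet f))
    (hmono : ∀ (t : ℕ) (x₁ x₂ : ℝ), x₁ ≤ x₂ → f (t, x₁) ≤ f (t, x₂))
    (hLip : ∀ (t : ℕ) (x₁ x₂ : ℝ), |f (t, x₁) - f (t, x₂)| ≤ |x₁ - x₂|)
    (hu : IsSolution f u) (hC : ∀ t, |u t| ≤ C) {ε : ℝ} (hε : 0 < ε) :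
    ∃ Q : Set ℝ, IsCompact Q ∧ ∃ η : ℝ, 0 < η ∧ ∀ τ : ℕ,
      (∃ L : ℕ, ∀ t : ℕ, L ≤ t → ∀ x ∈ Q, |f (t + τ, x) - f (t, x)| < η) →
      ∃ L : ℕ, ∀ t : ℕ, L ≤ t → |u (t + τ) - u t| < ε := by
  obtain ⟨n, hn⟩ :=
    exists_forall_limitPairs_abs_sub_lt hLagrange hminimal hmono hLip hu hC hε
  refine ⟨Set.Icc (-n) n, isCompact_Icc, 1 / ((n : ℝ) + 1), by positivity, fun τ ⟨L, hL⟩ => ?_⟩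
  suffices h : ∀ᶠ t : ℤ in atTop, |u ((τ : ℤ) + t).toNat - u ((0 : ℤ) + t).toNat| < ε by
    obtain ⟨L', hL'⟩ := eventually_atTop.1 h
    refine ⟨L'.toNat, fun t ht => ?_⟩
    have h1 := hL' t (by lia)
    rwa [show ((τ : ℤ) + t).toNat = t + τ by lia, show ((0 : ℤ) + t).toNat = t by lia] at h1
  -- An ultrafilter of bad times yields a limit pair that moves by at least `ε` under `τ`, although
  -- its right-hand side nearly has period `τ`.
  by_contra hcon
  have : (atTop ⊓ 𝓟 {t : ℤ |
      ¬|u ((τ : ℤ) + t).toNat - u ((0 : ℤ) + t).toNat| < ε}).NeBot :=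
    frequently_mem_iff_neBot.1 (not_eventually.1 hcon)
  obtain ⟨U, hU'⟩ := Ultrafilter.exists_le (atTop ⊓ 𝓟 {t : ℤ |
    ¬|u ((τ : ℤ) + t).toNat - u ((0 : ℤ) + t).toNat| < ε})
  obtain ⟨hU, hUε⟩ := le_inf_iff.1 hU'
  replace hUε : ∀ᶠ t : ℤ in (U : Filter ℤ),
      ¬|u ((τ : ℤ) + t).toNat - u ((0 : ℤ) + t).toNat| < ε := le_principal_iff.1 hUε
  obtain ⟨p, hp, hlim⟩ := exists_tendsto_extend hLip hu hC U hU
  have h1 : ε ≤ |p.2 τ - p.2 0| :=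
    ge_of_tendsto ((tendsto_extend_snd hlim τ).sub (tendsto_extend_snd hlim 0)).abs
      (hUε.mono fun t ht => not_lt.1 ht)
  refine absurd (hn τ p hp fun s x hx => ?_) (not_lt.2 h1)
  refine le_of_tendsto
    ((tendsto_extend_fst hlim (s + τ) x).sub (tendsto_extend_fst hlim s x)).abs ?_
  filter_upwards [hU (eventually_ge_atTop (L - s))] with t ht
  rw [show (s + τ + t).toNat = (s + t).toNat + τ by lia]
  exact (hL _ (by lia) x (abs_le.1 hx)).le

end Gap

end RemoteAP

theorem mainTheorem3 (f : C(ℕ × ℝ, ℝ))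
    (hLagrange : RemoteAP.PositivelyLagrangeStable f)
    (hminimal : RemoteAP.IsMinimalSet (RemoteAP.omegaLimitSet f))
    (hmono : ∀ (t : ℕ) (x₁ x₂ : ℝ), x₁ ≤ x₂ → f (t, x₁) ≤ f (t, x₂))
    (hLip : ∀ (t : ℕ) (x₁ x₂ : ℝ), |f (t, x₁) - f (t, x₂)| ≤ |x₁ - x₂|)
    (u : ℕ → ℝ) (hu : RemoteAP.IsSolution f u)
    (hbounded : ∃ C : ℝ, ∀ t : ℕ, |u t| ≤ C) :
    (RemoteAP.RemotelyAlmostPeriodicUnif f → RemoteAP.RemotelyAlmostPeriodic u) ∧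
    (∀ τ : ℕ, 0 < τ → RemoteAP.RemotelyPeriodicUnif τ f → RemoteAP.RemotelyPeriodic τ u) ∧
    (RemoteAP.RemotelyStationaryUnif f → RemoteAP.RemotelyStationary u) := by
  obtain ⟨C, hC⟩ := hbounded
  have key {ε : ℝ} (hε : 0 < ε) := RemoteAP.exists_forall_eventually_abs_sub_lt hLagrange hminimal
    hmono hLip hu hC hε
  have hper (τ : ℕ) (hτ : RemoteAP.RemotelyPeriodicUnif τ f) : RemoteAP.RemotelyPeriodic τ u := by
    refine Metric.tendsto_atTop.2 fun ε hε => ?_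
    obtain ⟨Q, hQ, η, hη, h⟩ := key hε
    obtain ⟨L, hL⟩ := h τ (hτ Q hQ η hη)
    exact ⟨L, fun t ht => by simpa using hL t ht⟩
  refine ⟨fun hf ε hε => ?_, fun τ _ => hper τ, fun hf τ => hper τ (hf τ)⟩
  obtain ⟨Q, hQ, η, hη, h⟩ := key hε
  obtain ⟨P, hP, hPτ⟩ := hf Q hQ η hη
  exact ⟨P, hP, fun τ hτ => h τ (hPτ τ hτ)⟩
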